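/- **Model.** An instance $\mathcal I$ consists of a memory capacity $M\in\mathbb N$ and $n\ge 1$ requests, all available at time $0$. Request $i$ has an integer prefill size $s_i\ge 1$ and an integer decode length $o_i\ge 1$ with $s_i+o_i\le M$. A schedule chooses an integer initiation time $p_i\ge 0$ for every request. Request $i$ then runs without preemption, occupies $s_i+(t-p_i)$ units of memory at each time $t$ with $p_i<t\le p_i+o_i$, and occupies no memory at other times. For a set $\mathcal X$ of requests let $M(\mathcal X,t)$ be the total memory occupied at time $t$ by the requests in $\mathcal X$. The schedule is feasible if the total memory of all requests is at most $M$ at every time. Its total end-to-end latency is $\mathrm{TEL}=\sum_i (p_i+o_i)$, and $\mathrm{TEL}(\texttt{Optimal};\mathcal I)$ is the minimum of $\mathrm{TEL}$ over all feasible schedules. **Algorithm Sorted-F.** For a nonempty set $\mathcal X$ of requests let $F(\mathcal X)=\sum_{i\in\mathcal X}o_i/|\mathcal X|^2$. *Phase 1.* While requests remain, choose among all nonempty sets $\mathcal X$ of remaining requests that satisfy $M(\mathcal X,o_i)\le M$ for all $i\in\mathcal X$ when all requests of $\mathcal X$ are initiated at time $0$, one that minimizes $(F(\mathcal X),-|\mathcal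 X|)$ lexicographically. Append the requests of $\mathcal X$ to a queue in ascending order of $o_i$, and remove them from the remaining requests. *Phase 2.* At each time $t=0,1,2,\dots$, initiate requests from the head of the queue one after the other, as long as initiating the head request $r$ at time $t$ keeps the memory of all requests initiated so far, including $r$, at most $M$ at the completion time of each of them. As soon as the head request fails this test, proceed to time $t+1$. Ties are broken arbitrarily. **Theorem.** On every instance Sorted-F produces a schedule, and every schedule that it can produce is feasible. Its competitive ratio satisfies $$\mathrm{CR}(\texttt{Sorted-F})=\sup_{\mathcal I}\frac{\mathrm{TEL}(\texttt{Sorted-F};\mathcal I)}{\mathrm{TEL}(\texttt{Optimal};\mathcal I)}<48,$$ where the supremum is over all instances $\mathcal I$ and all ways of breaking ties in Sorted-F. -/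

import Mathlib

open scoped ENNReal

namespace KVSched

/-- An offline instance: a memory capacity `M` and `n ≥ 1` requests, all available at time `0`.
Request `i` has prefill size `s i` and decode length `o i`, and fits into the memory by itself. -/
structure Inst where
  M : ℕ
  n : ℕ
  s : Fin n → ℕ
  o : Fin n → ℕ
  n_pos : 1 ≤ n
  s_pos : ∀ i, 1 ≤ s i
  o_pos : ∀ i, 1 ≤ o i
  fits : ∀ i, s i + o i ≤ M

namespace Inst

variable (I : Inst)

/-- Memory used at time `t` by the requests in `X` when request `i` is initiated at time `p i`.
Request `i` generates its `j`-th token at time `p i + j`, for `1 ≤ j ≤ o i`, without preemption;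
it then occupies `s i + j`, and it releases all of its memory after its last token. -/
def memory (X : Finset (Fin I.n)) (p : Fin I.n → ℕ) (t : ℕ) : ℕ :=
  ∑ i ∈ X with p i < t ∧ t ≤ p i + I.o i, (I.s i + (t - p i))

/-- A schedule, given by its initiation times, that respects the memory capacity at all times. -/
def Feasible (p : Fin I.n → ℕ) : Prop :=
  ∀ t, I.memory Finset.univ p t ≤ I.M

/-- Total end-to-end latency: the sum of all completion times. -/
def TEL (p : Fin I.n → ℕ) : ℕ :=
  ∑ i, (p i + I.o i)

/-- Total end-to-end latency of an optimal offline schedule. -/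
noncomputable def OPT : ℕ :=
  sInf {T | ∃ p, I.Feasible p ∧ I.TEL p = T}

/-- The quality metric `F(X) = (∑_{i ∈ X} o i) / |X|²`; it is only used for nonempty `X`. -/
def F (X : Finset (Fin I.n)) : ℚ :=
  ((∑ i ∈ X, I.o i : ℕ) : ℚ) / (X.card : ℚ) ^ 2

/-- A batch that respects the memory capacity, at each completion time in it, when all of its
requests are initiated together. -/
def BatchFeasible (X : Finset (Fin I.n)) : Prop :=
  ∀ i ∈ X, I.memory X (fun _ => 0) (I.o i) ≤ I.M

/-- `X` is a minimizer of `(F X, -|X|)`, lexicographically, among the nonempty memory-feasible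
subsets of `R`. -/
def IsBestBatch (R X : Finset (Fin I.n)) : Prop :=
  (X ⊆ R ∧ X.Nonempty ∧ I.BatchFeasible X) ∧
    ∀ Y ⊆ R, Y.Nonempty → I.BatchFeasible Y →
      I.F X < I.F Y ∨ (I.F X = I.F Y ∧ Y.card ≤ X.card)

/-- Batch construction. `Phase1 R L`: starting from the set `R` of requests that are not in a
batch yet, repeatedly selecting a best batch and listing it in ascending order of `o` can
produce the list `L`. Ties are broken arbitrarily. -/
inductive Phase1 : Finset (Fin I.n) → List (Fin I.n) → Prop
  | done : Phase1 ∅ []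
  | batch {R : Finset (Fin I.n)} {X L : List (Fin I.n)} :
      X.Nodup → I.IsBestBatch R X.toFinset → X.Pairwise (fun i j => I.o i ≤ I.o j) →
      Phase1 (R \ X.toFinset) L → Phase1 R (X ++ L)

/-- The admission test at time `t` for request `r`, where `A` is the set of requests initiated so
far (at the times `p`): if `r` is initiated now, the memory capacity is respected at the completion
time of `r` and of every request initiated so far. -/
def Admissible (p : Fin I.n → ℕ) (t : ℕ) (A : Finset (Fin I.n)) (r : Fin I.n) : Prop :=
  ∀ j ∈ insert r A,
    I.memory (insert r A) (Function.update p r t) (Function.update p r t j + I.o j) ≤ I.M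

/-- Scheduling execution. `Phase2 p t A L`: from time `t` on, with `A` initiated so far and the
pending requests queued in the order `L`, the execution initiates each request `r` of `L` at time
`p r`. At each time, requests are admitted from the head of the queue as long as the head passes
the admission test; once it fails, nothing more is initiated before the next time step. -/
inductive Phase2 (p : Fin I.n → ℕ) : ℕ → Finset (Fin I.n) → List (Fin I.n) → Prop
  | done {t : ℕ} {A : Finset (Fin I.n)} : Phase2 p t A []
  | start {t : ℕ} {A : Finset (Fin I.n)} {r : Fin I.n} {L : List (Fin I.n)} :
      I.Admissible p t A r → p r = t → Phase2 p t (insert r A) L → Phase2 p t A (r :: L)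
  | wait {t : ℕ} {A : Finset (Fin I.n)} {r : Fin I.n} {L : List (Fin I.n)} :
      ¬ I.Admissible p t A r → Phase2 p (t + 1) A (r :: L) → Phase2 p t A (r :: L)

/-- `p` is the schedule produced by some run of Sorted-F (some way of breaking the ties). -/
def IsSortedF (p : Fin I.n → ℕ) : Prop :=
  ∃ L, I.Phase1 Finset.univ L ∧ I.Phase2 p 0 ∅ L

end Inst

/-- Competitive ratio of Sorted-F: the supremum of `TEL(Sorted-F; I) / TEL(Optimal; I)` over all
instances `I` and all ways of breaking the ties in Sorted-F. -/
noncomputable def competitiveRatio : ℝ≥0∞ :=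
  ⨆ (I : Inst) (p : Fin I.n → ℕ) (_ : I.IsSortedF p), (I.TEL p : ℝ≥0∞) / (I.OPT : ℝ≥0∞)

end KVSched

/-!
Sorted-F is in fact `40`-competitive. Write `w i = s i + o i`, and let `X` be a best batch chosen
from the set `R` of remaining requests.

*Delay caused by a batch.* Removing one request from `X` does not decrease `F`, so no request of `X`
is longer than twice the average, which is `2 * |X| * F X` (`IsBestBatch.o_le`). If everything
queued before `X` is completed by time `T`, then all of `X` has been started by time `T`
(`Phase2.batch_start`): as the requests of `X` are queued in ascending order of `o`, starting some of
them early only lowers the memory needed at later completion times. So `X` delays the requests of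
`R` by at most `2 * |X| * F X` each.

*Speed of any schedule.* No feasible schedule completes more than `5 * t / F X` requests of `R` by
time `t` (`IsBestBatch.F_mul_card_completed_le`). The completed requests have area
`∑ o i * w i ≤ 2 * M * t`, because memory grows linearly and a request thus fills at least half of
its rectangle. On the other hand, requests `i` with `q * w i ≤ M` fit together `q` at a time, so by
the choice of `X` fewer than `q` of them satisfy `o i < q * F X`. Hence the
requests have area at least `M * F X / 2` each, up to a total deficit worth at most `t / F X`
requests (`packing_bound`).

*Charging.* Charge every request of `X` the price `F X * |R| / 10`. The delays of Sorted-F add up to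
`20` times the sum of the prices. By the second fact, at any time below the price of `X` at least
half of `R` is unfinished in an optimal schedule; so, for every `u`, the number of prices above `u`
is at most twice the number of optimal completion times above `u`, and summing over `u` bounds the
sum of the prices by twice the optimum (`Phase1.exists_price`, `sum_le_two_mul_sum_of_card_le`).
-/

namespace KVSched

/-! ### A packing inequality -/

/-- An interval `[1, m]` contains at most `x / f` integers `q` with `f * q ≤ x`. -/
lemma mul_card_filter_mul_le {f : ℚ} (hf : 0 < f) (m x : ℕ) :
    f * ((Finset.Icc 1 m).filter (fun q : ℕ => f * q ≤ x)).card ≤ x := by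
  have hsub : (Finset.Icc 1 m).filter (fun q : ℕ => f * q ≤ x) ⊆
      Finset.Icc 1 ⌊(x : ℚ) / f⌋₊ := by
    intro q hq
    simp only [Finset.mem_filter, Finset.mem_Icc] at hq ⊢
    refine ⟨hq.1.1, Nat.le_floor ?_⟩
    rw [le_div_iff₀ hf]
    linarith [hq.2]
  have hcard := Finset.card_le_card hsub
  rw [Nat.card_Icc, Nat.add_sub_cancel] at hcard
  have h1 : (((Finset.Icc 1 m).filter (fun q : ℕ => f * q ≤ x)).card : ℚ) ≤ (x : ℚ) / f :=
    (Nat.cast_le.mpr hcard).trans (Nat.floor_le (by positivity))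
  rw [le_div_iff₀ hf] at h1
  linarith

/-- A maximal set `B` that fits into the capacity `M` among the initial segments of `S` in the
order of increasing width. -/
lemma exists_maximal_prefix {ι : Type*} [DecidableEq ι] (S : Finset ι) (w : ι → ℕ) (M : ℕ) :
    ∃ B ⊆ S, ∑ i ∈ B, w i ≤ M ∧
      (B = S ∨ ∃ i₀ ∈ S, M < ∑ i ∈ B, w i + w i₀ ∧ (∀ j ∈ B, w j ≤ w i₀) ∧
        ∀ i ∈ S, i ∉ B → w i₀ ≤ w i) := by
  classical
  let cand := S.powerset.filter
    (fun B => ∑ i ∈ B, w i ≤ M ∧ ∀ j ∈ B, ∀ i ∈ S, i ∉ B → w j ≤ w i)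
  have hne : cand.Nonempty := ⟨∅, by simp [cand]⟩
  obtain ⟨B, hB, hmax⟩ := Finset.exists_max_image cand Finset.card hne
  simp only [cand, Finset.mem_filter, Finset.mem_powerset] at hB
  obtain ⟨hBS, hBM, hpre⟩ := hB
  refine ⟨B, hBS, hBM, ?_⟩
  by_cases hEq : B = S
  · exact Or.inl hEq
  right
  have hdiff : (S \ B).Nonempty := by
    rw [Finset.sdiff_nonempty]
    exact fun h => hEq (Finset.Subset.antisymm hBS h)
  obtain ⟨i₀, hi₀, hmin⟩ := Finset.exists_min_image (S \ B) w hdiff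
  rw [Finset.mem_sdiff] at hi₀
  refine ⟨i₀, hi₀.1, ?_, fun j hj => hpre j hj i₀ hi₀.1 hi₀.2,
    fun i hi hiB => hmin i (Finset.mem_sdiff.mpr ⟨hi, hiB⟩)⟩
  by_contra hle
  have hmem : insert i₀ B ∈ cand := by
    simp only [cand, Finset.mem_filter, Finset.mem_powerset]
    refine ⟨Finset.insert_subset hi₀.1 hBS, ?_, ?_⟩
    · rw [Finset.sum_insert hi₀.2]
      omega
    · intro j hj i hi hiB
      rw [Finset.mem_insert, not_or] at hiB
      rcases Finset.mem_insert.mp hj with rfl | hj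
      · exact hmin i (Finset.mem_sdiff.mpr ⟨hi, hiB.2⟩)
      · exact hpre j hj i hi hiB.2
  have := hmax _ hmem
  rw [Finset.card_insert_of_notMem hi₀.2] at this
  omega

/-- The packing inequality. If every subfamily `Y` of total width at most `M` satisfies
`f * |Y|² ≤ ∑ o`, then the family as a whole has large area `∑ o * w`.

Jobs with `q ≤ M / w i` have the property that any `q` of them fit together, so fewer than `q` of
them have `o i < f * q`. The fraction of the `q ∈ [1, M / w i]` with `o i < f * q` measures by how
much the area of job `i` falls short of `f * M / 2`. These deficits add up to at most `t / f`. -/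
lemma packing_bound {ι : Type*} [DecidableEq ι] (S : Finset ι) (w o : ι → ℕ) (M t : ℕ) (f : ℚ)
    (hf : 0 < f) (hw : ∀ i ∈ S, 1 ≤ w i) (hwM : ∀ i ∈ S, w i ≤ M) (ho : ∀ i ∈ S, o i ≤ t)
    (hY : ∀ Y ⊆ S, ∑ i ∈ Y, w i ≤ M → f * (Y.card : ℚ) ^ 2 ≤ ∑ i ∈ Y, (o i : ℚ)) :
    f * S.card * M ≤ t * M + 2 * ∑ i ∈ S, (o i : ℚ) * w i := by
  classical
  -- a family that fits has at most `t / f` members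
  have hfit : ∀ Y ⊆ S, ∑ i ∈ Y, w i ≤ M → f * Y.card ≤ t := by
    intro Y hYS hYM
    rcases Y.eq_empty_or_nonempty with rfl | hne
    · simp
    have h1 := hY Y hYS hYM
    have h2 : ∑ i ∈ Y, (o i : ℚ) ≤ Y.card * t := by
      rw [← nsmul_eq_mul]
      exact Finset.sum_le_card_nsmul _ _ _ fun i hi => by exact_mod_cast ho i (hYS hi)
    have h3 : (0 : ℚ) < Y.card := by exact_mod_cast hne.card_pos
    nlinarith
  obtain ⟨B, hBS, hBM, hB⟩ := exists_maximal_prefix S w M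
  have hcardB := hfit B hBS hBM
  have harea : (0 : ℚ) ≤ ∑ i ∈ S, (o i : ℚ) * w i := Finset.sum_nonneg fun i _ => by positivity
  have hM0 : (0 : ℚ) ≤ M := Nat.cast_nonneg M
  rcases hB with rfl | ⟨i₀, hi₀S, hi₀M, hBi₀, hi₀B⟩
  · nlinarith
  let q : ι → ℕ := fun i => M / w i
  have hq1 : ∀ i ∈ S, 1 ≤ q i := fun i hi =>
    (Nat.one_le_div_iff (hw i hi)).mpr (hwM i hi)
  have hqw : ∀ i, q i * w i ≤ M := fun i => Nat.div_mul_le_self M (w i)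
  have hqw' : ∀ i ∈ S, M < (q i + 1) * w i := fun i hi =>
    Nat.lt_mul_of_div_lt (Nat.lt_succ_self _) (hw i hi)
  have hMpos : (0 : ℚ) < M := by
    have := hw i₀ hi₀S
    have := hwM i₀ hi₀S
    exact_mod_cast (by omega : 0 < M)
  let Q := q i₀
  let lo : ι → Finset ℕ := fun i =>
    (Finset.Icc 1 Q).filter (fun k : ℕ => k ≤ q i ∧ (o i : ℚ) < f * k)
  let hi : ι → ℕ := fun i => q i - Q
  let e : ι → ℚ := fun i => ((lo i).card + hi i : ℚ) / q i
  -- each job is paid for by its deficit and by its area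
  have hpay : ∀ i ∈ S, 1 ≤ e i + 2 * ((o i : ℚ) * w i) / (f * M) := by
    intro i hiS
    have hqpos : (0 : ℚ) < q i := by exact_mod_cast hq1 i hiS
    have hcount : q i ≤ (lo i).card + hi i +
        ((Finset.Icc 1 (q i)).filter (fun k : ℕ => f * k ≤ o i)).card := by
      have hcov : Finset.Icc 1 (q i) ⊆ (lo i ∪ Finset.Ioc Q (q i)) ∪
          (Finset.Icc 1 (q i)).filter (fun k : ℕ => f * k ≤ o i) := by
        intro k hk
        simp only [lo, Finset.mem_union, Finset.mem_filter, Finset.mem_Icc, Finset.mem_Ioc] at hk ⊢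
        by_cases h1 : f * k ≤ o i
        · exact Or.inr ⟨hk, h1⟩
        · by_cases h2 : k ≤ Q
          · exact Or.inl (Or.inl ⟨⟨hk.1, h2⟩, hk.2, not_le.mp h1⟩)
          · exact Or.inl (Or.inr ⟨not_le.mp h2, hk.2⟩)
      have h1 := (Finset.card_le_card hcov).trans (Finset.card_union_le _ _)
      have h2 := Finset.card_union_le (lo i) (Finset.Ioc Q (q i))
      rw [Nat.card_Ioc] at h2
      rw [Nat.card_Icc, Nat.add_sub_cancel] at h1
      simp only [hi]
      omega
    have hlen := mul_card_filter_mul_le hf (q i) (o i)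
    set c := ((Finset.Icc 1 (q i)).filter (fun k : ℕ => f * k ≤ o i)).card with hc
    have hcountQ : (q i : ℚ) ≤ ((lo i).card + hi i : ℚ) + c := by exact_mod_cast hcount
    have hc' : (c : ℚ) / q i ≤ 2 * ((o i : ℚ) * w i) / (f * M) := by
      rw [div_le_div_iff₀ hqpos (by positivity)]
      have hMw : (M : ℚ) ≤ 2 * (q i * w i) := by
        have h1 := hqw' i hiS
        have h2 := hq1 i hiS
        have : M ≤ 2 * (q i * w i) := by nlinarith
        exact_mod_cast this
      calc (c : ℚ) * (f * M) = (f * c) * M := by ring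
        _ ≤ o i * (2 * (q i * w i)) :=
            mul_le_mul hlen hMw hM0 (Nat.cast_nonneg _)
        _ = 2 * ((o i : ℚ) * w i) * q i := by ring
    have h1 : 1 ≤ e i + (c : ℚ) / q i := by
      simp only [e]
      rw [← add_div, le_div_iff₀ hqpos]
      linarith
    linarith
  -- at most `k - 1` jobs have a deficit at level `k`
  have hlevel : ∀ k ∈ Finset.Icc 1 Q,
      ((S.filter (fun i => k ≤ q i ∧ (o i : ℚ) < f * k)).card : ℚ) ≤ k - 1 := by
    intro k hk
    have hk1 := (Finset.mem_Icc.mp hk).1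
    have : (S.filter (fun i => k ≤ q i ∧ (o i : ℚ) < f * k)).card < k := by
      by_contra hge
      obtain ⟨Y, hYsub, hYcard⟩ := Finset.exists_subset_card_eq (not_lt.mp hge)
      have hYS : Y ⊆ S := hYsub.trans (Finset.filter_subset _ _)
      have hYmem : ∀ i ∈ Y, k ≤ q i ∧ (o i : ℚ) < f * k := fun i hi =>
        (Finset.mem_filter.mp (hYsub hi)).2
      have hkpos : 0 < k := hk1
      have hYM : ∑ i ∈ Y, w i ≤ M := by
        have h1 : ∑ i ∈ Y, w i ≤ Y.card • (M / k) := by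
          refine Finset.sum_le_card_nsmul _ _ _ fun i hi => ?_
          rw [Nat.le_div_iff_mul_le hkpos, mul_comm]
          exact (Nat.mul_le_mul_right _ (hYmem i hi).1).trans (hqw i)
        rw [hYcard, smul_eq_mul] at h1
        exact h1.trans (Nat.mul_div_le M k)
      have h1 := hY Y hYS hYM
      have hYne : Y.Nonempty := Finset.card_pos.mp (by omega)
      have h2 : ∑ i ∈ Y, (o i : ℚ) < ∑ _i ∈ Y, f * k :=
        Finset.sum_lt_sum_of_nonempty hYne fun i hi => (hYmem i hi).2
      rw [Finset.sum_const, nsmul_eq_mul, hYcard] at h2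
      rw [hYcard] at h1
      nlinarith
    have h2 : ((S.filter (fun i => k ≤ q i ∧ (o i : ℚ) < f * k)).card : ℚ) + 1 ≤ k := by
      exact_mod_cast this
    linarith
  have hlow : ∑ i ∈ S, ((lo i).card : ℚ) / q i ≤ Q - 1 := by
    have hQ1 : 1 ≤ Q := hq1 i₀ hi₀S
    have hswap : ∑ i ∈ S, ((lo i).card : ℚ) / q i = ∑ k ∈ Finset.Icc 1 Q,
        ∑ i ∈ S.filter (fun i => k ≤ q i ∧ (o i : ℚ) < f * k), (1 : ℚ) / q i := by
      simp_rw [Finset.sum_filter]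
      rw [Finset.sum_comm]
      refine Finset.sum_congr rfl fun i _ => ?_
      rw [← Finset.sum_filter, Finset.sum_const, nsmul_eq_mul, mul_one_div]
    have hterm : ∀ k ∈ Finset.Icc 1 Q,
        ∑ i ∈ S.filter (fun i => k ≤ q i ∧ (o i : ℚ) < f * k), (1 : ℚ) / q i ≤
          if k = 1 then 0 else 1 := by
      intro k hk
      have hk1 : (1 : ℚ) ≤ k := by exact_mod_cast (Finset.mem_Icc.mp hk).1
      have h1 : ∑ i ∈ S.filter (fun i => k ≤ q i ∧ (o i : ℚ) < f * k), (1 : ℚ) / q i ≤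
          (S.filter (fun i => k ≤ q i ∧ (o i : ℚ) < f * k)).card • ((1 : ℚ) / k) := by
        refine Finset.sum_le_card_nsmul _ _ _ fun i hi => ?_
        have : (k : ℚ) ≤ q i := by exact_mod_cast (Finset.mem_filter.mp hi).2.1
        exact one_div_le_one_div_of_le (by linarith) this
      have h2 := hlevel k hk
      rw [nsmul_eq_mul, mul_one_div] at h1
      have h3 : ((S.filter (fun i => k ≤ q i ∧ (o i : ℚ) < f * k)).card : ℚ) / k ≤ (k - 1) / k :=
        div_le_div_of_nonneg_right h2 (by linarith)
      refine h1.trans (h3.trans ?_)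
      split_ifs with hk'
      · simp [hk']
      · rw [div_le_one (by linarith)]
        linarith
    rw [hswap]
    refine (Finset.sum_le_sum hterm).trans ?_
    have hmem : 1 ∈ Finset.Icc 1 Q := Finset.mem_Icc.mpr ⟨le_rfl, hQ1⟩
    rw [← Finset.add_sum_erase _ _ hmem, if_pos rfl, zero_add]
    have : ∑ k ∈ (Finset.Icc 1 Q).erase 1, (if k = 1 then (0 : ℚ) else 1) =
        ∑ k ∈ (Finset.Icc 1 Q).erase 1, 1 :=
      Finset.sum_congr rfl fun k hk => if_neg (Finset.ne_of_mem_erase hk)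
    rw [this, Finset.sum_const, Finset.card_erase_of_mem hmem, Nat.card_Icc, Nat.add_sub_cancel,
      nsmul_eq_mul, mul_one, Nat.cast_sub hQ1, Nat.cast_one]
  -- above level `Q` only the jobs of `B` have deficits, and `B` nearly fills the capacity
  have hhigh : ∑ i ∈ S, (hi i : ℚ) / q i ≤ B.card - Q + 1 := by
    have hout : ∀ i ∈ S, i ∉ B → (hi i : ℚ) / q i = 0 := by
      intro i hiS hiB
      have : q i ≤ Q := Nat.div_le_div_left (hi₀B i hiS hiB) (hw i₀ hi₀S)
      simp [hi, Nat.sub_eq_zero_of_le this]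
    rw [← Finset.sum_subset hBS hout]
    have hin : ∀ i ∈ B, (hi i : ℚ) / q i ≤ 1 - Q * ((w i : ℚ) / M) := by
      intro i hiB
      have hqpos : (0 : ℚ) < q i := by exact_mod_cast hq1 i (hBS hiB)
      have hQq : Q ≤ q i := Nat.div_le_div_left (hBi₀ i hiB) (hw i (hBS hiB))
      have h1 : (w i : ℚ) / M ≤ 1 / q i := by
        rw [div_le_div_iff₀ hMpos hqpos]
        have := hqw i
        rw [one_mul, mul_comm]
        exact_mod_cast this
      have h2 : (hi i : ℚ) / q i = 1 - Q * (1 / q i) := by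
        simp only [hi]
        rw [Nat.cast_sub hQq]
        field_simp
      rw [h2]
      have : (0 : ℚ) ≤ Q := Nat.cast_nonneg _
      nlinarith
    refine (Finset.sum_le_sum hin).trans ?_
    rw [Finset.sum_sub_distrib, ← Finset.mul_sum, ← Finset.sum_div, Finset.sum_const, nsmul_eq_mul,
      mul_one]
    have h3 : (M : ℚ) ≤ ∑ i ∈ B, (w i : ℚ) + w i₀ := by exact_mod_cast hi₀M.le
    have h4 : (Q : ℚ) * w i₀ ≤ M := by exact_mod_cast hqw i₀
    have h5 : (Q : ℚ) - 1 ≤ Q * ((∑ i ∈ B, (w i : ℚ)) / M) := by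
      rw [mul_div_assoc', le_div_iff₀ hMpos]
      have : (0 : ℚ) ≤ Q := Nat.cast_nonneg _
      nlinarith
    linarith
  have hdef : ∑ i ∈ S, e i ≤ B.card := by
    simp only [e, add_div]
    rw [Finset.sum_add_distrib]
    linarith
  have hsum : (S.card : ℚ) ≤ B.card + 2 * (∑ i ∈ S, (o i : ℚ) * w i) / (f * M) := by
    have h1 := Finset.sum_le_sum hpay
    rw [Finset.sum_const, nsmul_eq_mul, mul_one, Finset.sum_add_distrib, ← Finset.sum_div,
      ← Finset.mul_sum] at h1
    linarith
  have hfM : 0 < f * M := by positivity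
  have h6 := mul_le_mul_of_nonneg_left hsum hfM.le
  rw [mul_add, mul_div_cancel₀ _ hfM.ne'] at h6
  nlinarith

namespace Inst

variable (I : Inst)

/-! ### Memory usage and area -/

lemma memory_mono {X Y : Finset (Fin I.n)} (h : X ⊆ Y) (p : Fin I.n → ℕ) (t : ℕ) :
    I.memory X p t ≤ I.memory Y p t :=
  Finset.sum_le_sum_of_subset (Finset.filter_subset_filter _ h)

lemma memory_congr {X : Finset (Fin I.n)} {p p' : Fin I.n → ℕ} (h : ∀ i ∈ X, p i = p' i) (t : ℕ) :
    I.memory X p t = I.memory X p' t := by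
  unfold memory
  rw [Finset.sum_filter, Finset.sum_filter]
  exact Finset.sum_congr rfl fun i hi => by rw [h i hi]

/-- The requests outside `X` that are inactive at time `t` may be dropped. -/
lemma memory_eq_of_subset {X Y : Finset (Fin I.n)} (h : X ⊆ Y) (p : Fin I.n → ℕ) (t : ℕ)
    (hout : ∀ i ∈ Y, i ∉ X → ¬ (p i < t ∧ t ≤ p i + I.o i)) :
    I.memory Y p t = I.memory X p t := by
  unfold memory
  congr 1
  ext i
  simp only [Finset.mem_filter]
  constructor
  · rintro ⟨hi, hact⟩
    by_contra hcon
    exact hout i hi (fun hX => hcon ⟨hX, hact⟩) hact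
  · rintro ⟨hi, hact⟩
    exact ⟨h hi, hact⟩

/-- Memory grows up to the next completion, so it suffices to check the completion times. -/
lemma memory_le_of_completion {X : Finset (Fin I.n)} {p : Fin I.n → ℕ}
    (h : ∀ j ∈ X, I.memory X p (p j + I.o j) ≤ I.M) (t : ℕ) : I.memory X p t ≤ I.M := by
  classical
  rcases (X.filter (fun i => p i < t ∧ t ≤ p i + I.o i)).eq_empty_or_nonempty with he | hne
  · unfold memory
    rw [he]
    simp
  obtain ⟨j, hj, hmin⟩ := Finset.exists_min_image _ (fun i => p i + I.o i) hne
  refine le_trans ?_ (h j (Finset.mem_filter.mp hj).1)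
  unfold memory
  have hjt := (Finset.mem_filter.mp hj).2.2
  calc ∑ i ∈ X with p i < t ∧ t ≤ p i + I.o i, (I.s i + (t - p i))
      ≤ ∑ i ∈ X with p i < t ∧ t ≤ p i + I.o i, (I.s i + (p j + I.o j - p i)) :=
        Finset.sum_le_sum fun i _ => by omega
    _ ≤ _ := by
        refine Finset.sum_le_sum_of_subset fun i hi => ?_
        have h1 := hmin i hi
        simp only [Finset.mem_filter] at hi ⊢
        exact ⟨hi.1, by omega, h1⟩

lemma batchFeasible_of_sum_le {X : Finset (Fin I.n)} (h : ∑ i ∈ X, (I.s i + I.o i) ≤ I.M) :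
    I.BatchFeasible X := by
  intro i _
  refine le_trans ?_ h
  unfold memory
  refine (Finset.sum_le_sum fun j hj => ?_).trans
    (Finset.sum_le_sum_of_subset (Finset.filter_subset _ _))
  have := (Finset.mem_filter.mp hj).2
  omega

lemma BatchFeasible.subset {X Y : Finset (Fin I.n)} (hY : I.BatchFeasible Y) (h : X ⊆ Y) :
    I.BatchFeasible X :=
  fun i hi => (I.memory_mono h _ _).trans (hY i (h hi))

lemma two_mul_sum_Ioc (s p o : ℕ) :
    2 * ∑ τ ∈ Finset.Ioc p (p + o), (s + (τ - p)) = o * (2 * s + o + 1) := by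
  induction o with
  | zero => simp
  | succ o ih =>
    rw [← add_assoc, Finset.sum_Ioc_succ_top (Nat.le_add_right p o), mul_add, ih,
      show p + o + 1 - p = o + 1 by omega]
    ring

/-- The requests completed by time `t` occupy a total area of at most `M * t`, and a request takes
up at least half of the rectangle of width `s i + o i` and length `o i`. -/
lemma sum_area_le {p : Fin I.n → ℕ} (hp : I.Feasible p) {S : Finset (Fin I.n)} {t : ℕ}
    (hS : ∀ i ∈ S, p i + I.o i ≤ t) :
    ∑ i ∈ S, I.o i * (I.s i + I.o i) ≤ 2 * (I.M * t) := by
  have h1 : ∑ τ ∈ Finset.Ioc 0 t, I.memory S p τ ≤ I.M * t := by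
    have := Finset.sum_le_card_nsmul (Finset.Ioc 0 t) (fun τ => I.memory S p τ) I.M
      fun τ _ => (I.memory_mono (Finset.subset_univ S) p τ).trans (hp τ)
    rw [Nat.card_Ioc, Nat.sub_zero, smul_eq_mul] at this
    rwa [mul_comm]
  have h2 : ∑ τ ∈ Finset.Ioc 0 t, I.memory S p τ =
      ∑ i ∈ S, ∑ τ ∈ Finset.Ioc (p i) (p i + I.o i), (I.s i + (τ - p i)) := by
    unfold memory
    simp_rw [Finset.sum_filter]
    rw [Finset.sum_comm]
    refine Finset.sum_congr rfl fun i hi => ?_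
    rw [← Finset.sum_filter]
    congr 1
    ext τ
    have := hS i hi
    simp only [Finset.mem_filter, Finset.mem_Ioc]
    omega
  have h3 : ∑ i ∈ S, I.o i * (I.s i + I.o i) ≤
      2 * ∑ i ∈ S, ∑ τ ∈ Finset.Ioc (p i) (p i + I.o i), (I.s i + (τ - p i)) := by
    rw [Finset.mul_sum]
    refine Finset.sum_le_sum fun i _ => ?_
    rw [two_mul_sum_Ioc]
    exact Nat.mul_le_mul_left _ (by omega)
  rw [← h2] at h3
  omega

/-! ### Best batches -/

lemma F_pos {X : Finset (Fin I.n)} (hX : X.Nonempty) : 0 < I.F X := by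
  have h1 : 0 < ∑ i ∈ X, I.o i := Finset.sum_pos (fun i _ => I.o_pos i) hX
  have h2 := hX.card_pos
  unfold F
  positivity

lemma F_mul_card_sq {X : Finset (Fin I.n)} (hX : X.Nonempty) :
    I.F X * (X.card : ℚ) ^ 2 = ∑ i ∈ X, (I.o i : ℚ) := by
  have h2 : (0 : ℚ) < X.card := by exact_mod_cast hX.card_pos
  unfold F
  rw [div_mul_cancel₀ _ (by positivity)]
  push_cast
  rfl

lemma IsBestBatch.F_le {R X Y : Finset (Fin I.n)} (h : I.IsBestBatch R X) (hY : Y ⊆ R)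
    (hne : Y.Nonempty) (hf : I.BatchFeasible Y) : I.F X ≤ I.F Y := by
  rcases h.2 Y hY hne hf with h | h
  · exact h.le
  · exact h.1.le

/-- No schedule completes requests of `R` at a rate of more than `5 / F X`, where `X` is a best
batch in `R`. -/
lemma IsBestBatch.F_mul_card_completed_le {R X : Finset (Fin I.n)} (h : I.IsBestBatch R X)
    {p : Fin I.n → ℕ} (hp : I.Feasible p) (t : ℕ) :
    I.F X * (R.filter (fun i => p i + I.o i ≤ t)).card ≤ 5 * t := by
  set S := R.filter (fun i => p i + I.o i ≤ t) with hSdef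
  have hSR : S ⊆ R := Finset.filter_subset _ _
  have hSt : ∀ i ∈ S, p i + I.o i ≤ t := fun i hi => (Finset.mem_filter.mp hi).2
  have hpack := packing_bound S (fun i => I.s i + I.o i) I.o I.M t (I.F X) (I.F_pos h.1.2.1)
    (fun i _ => by have := I.s_pos i; omega) (fun i _ => I.fits i)
    (fun i hi => by have := hSt i hi; omega) (by
      intro Y hYS hYM
      rcases Y.eq_empty_or_nonempty with rfl | hne
      · simp
      rw [← I.F_mul_card_sq hne]
      exact mul_le_mul_of_nonneg_right
        (IsBestBatch.F_le I h (hYS.trans hSR) hne (I.batchFeasible_of_sum_le hYM)) (by positivity))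
  have harea := I.sum_area_le hp hSt
  have harea' : ∑ i ∈ S, (I.o i : ℚ) * ((I.s i + I.o i : ℕ) : ℚ) ≤ 2 * (I.M * t) := by
    exact_mod_cast harea
  have hM : (0 : ℚ) < I.M := by
    have h1 := I.s_pos ⟨0, I.n_pos⟩
    have h2 := I.fits ⟨0, I.n_pos⟩
    exact_mod_cast (by omega : 0 < I.M)
  have : I.F X * S.card * I.M ≤ 5 * t * I.M := by linarith
  exact le_of_mul_le_mul_right this hM

/-- Removing request `i` does not improve a best batch, so `o i` is at most twice the average. -/
lemma IsBestBatch.o_le {R X : Finset (Fin I.n)} (h : I.IsBestBatch R X) {i : Fin I.n}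
    (hi : i ∈ X) : (I.o i : ℚ) ≤ 2 * X.card * I.F X := by
  have hXne := h.1.2.1
  have hF := I.F_pos hXne
  have hsq := I.F_mul_card_sq hXne
  have hsplit := Finset.add_sum_erase X (fun j => (I.o j : ℚ)) hi
  have hcard : ((X.erase i).card : ℚ) + 1 = X.card := by
    exact_mod_cast Finset.card_erase_add_one hi
  rcases (X.erase i).eq_empty_or_nonempty with he | hne
  · rw [he] at hcard hsplit
    simp only [Finset.card_empty, Nat.cast_zero, zero_add, Finset.sum_empty, add_zero]
      at hcard hsplit
    rw [← hcard] at hsq ⊢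
    linarith
  · have h1 := IsBestBatch.F_le I h ((Finset.erase_subset _ _).trans h.1.1) hne
      (h.1.2.2.subset I (Finset.erase_subset _ _))
    have h2 := I.F_mul_card_sq hne
    set k : ℚ := ((X.erase i).card : ℚ)
    have h3 := mul_le_mul_of_nonneg_right h1 (sq_nonneg k)
    rw [← hcard] at hsq ⊢
    nlinarith

/-! ### Existence of batch constructions -/

lemma exists_isBestBatch {R : Finset (Fin I.n)} (hR : R.Nonempty) : ∃ X, I.IsBestBatch R X := by
  classical
  let cand := R.powerset.filter (fun X => X.Nonempty ∧ I.BatchFeasible X)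
  have hcand : ∀ X, X ∈ cand ↔ X ⊆ R ∧ X.Nonempty ∧ I.BatchFeasible X := by
    intro X
    simp [cand]
  have hne : cand.Nonempty := by
    obtain ⟨i, hi⟩ := hR
    refine ⟨{i}, (hcand _).mpr ⟨by simpa using hi, by simp, I.batchFeasible_of_sum_le ?_⟩⟩
    simpa using I.fits i
  obtain ⟨X₀, hX₀, hmin⟩ := Finset.exists_min_image cand I.F hne
  obtain ⟨X, hX, hmax⟩ := Finset.exists_max_image (cand.filter (fun X => I.F X = I.F X₀))
    Finset.card ⟨X₀, by simp [hX₀]⟩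
  rw [Finset.mem_filter] at hX
  refine ⟨X, (hcand X).mp hX.1, fun Y hYR hYne hYf => ?_⟩
  have hY := (hcand Y).mpr ⟨hYR, hYne, hYf⟩
  rcases (hmin Y hY).lt_or_eq with h | h
  · exact Or.inl (hX.2 ▸ h)
  · exact Or.inr ⟨hX.2.trans h, hmax Y (Finset.mem_filter.mpr ⟨hY, h.symm⟩)⟩

lemma exists_phase1 (R : Finset (Fin I.n)) : ∃ L, I.Phase1 R L := by
  classical
  induction R using Finset.strongInduction with
  | H R ih =>
    rcases R.eq_empty_or_nonempty with rfl | hR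
    · exact ⟨[], .done⟩
    obtain ⟨X, hX⟩ := I.exists_isBestBatch hR
    obtain ⟨L, hL⟩ := ih (R \ X) (Finset.sdiff_ssubset hX.1.1 hX.1.2.1)
    let xs := X.toList.mergeSort (fun i j => decide (I.o i ≤ I.o j))
    have hperm : xs.Perm X.toList := List.mergeSort_perm _ _
    have hxs : xs.toFinset = X := by
      rw [List.toFinset_eq_of_perm _ _ hperm, Finset.toList_toFinset]
    refine ⟨xs ++ L, .batch (hperm.nodup_iff.mpr X.nodup_toList) (by rwa [hxs]) ?_ (by rwa [hxs])⟩
    have hsorted : xs.Pairwise (fun i j => decide (I.o i ≤ I.o j) = true) :=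
      List.pairwise_mergeSort
        (fun a b c h1 h2 => by
          simp only [decide_eq_true_eq] at *
          exact h1.trans h2)
        (fun a b => by
          simp only [Bool.or_eq_true, decide_eq_true_eq]
          exact le_total _ _) _
    exact hsorted.imp fun h => of_decide_eq_true h

lemma Phase1.toFinset_eq {R : Finset (Fin I.n)} {L : List (Fin I.n)} (h : I.Phase1 R L) :
    L.toFinset = R := by
  induction h with
  | done => rfl
  | batch _ hX _ _ ih =>
    rw [List.toFinset_append, ih, Finset.union_sdiff_of_subset hX.1.1]

lemma Phase1.nodup {R : Finset (Fin I.n)} {L : List (Fin I.n)} (h : I.Phase1 R L) : L.Nodup := by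
  induction h with
  | done => exact List.nodup_nil
  | batch hnd _ _ hL ih =>
    refine List.Nodup.append hnd ih fun i hi hiL => ?_
    have := hL.toFinset_eq
    rw [← List.mem_toFinset, this, Finset.mem_sdiff] at hiL
    exact hiL.2 (List.mem_toFinset.mpr hi)

/-! ### Runs of the admission rule -/

/-- The requests of `A`, started at the times `p`, respect the memory capacity at the completion
time of each of them. -/
def FeasibleOn (p : Fin I.n → ℕ) (A : Finset (Fin I.n)) : Prop :=
  ∀ j ∈ A, I.memory A p (p j + I.o j) ≤ I.M

lemma Admissible.feasibleOn {p : Fin I.n → ℕ} {A : Finset (Fin I.n)} {r : Fin I.n}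
    (h : I.Admissible p (p r) A r) : I.FeasibleOn p (insert r A) := by
  unfold Admissible at h
  rwa [Function.update_eq_self] at h

lemma admissible_congr {p p' : Fin I.n → ℕ} {t : ℕ} {A : Finset (Fin I.n)} {r : Fin I.n}
    (h : ∀ i ∈ A, p i = p' i) (hadm : I.Admissible p t A r) : I.Admissible p' t A r := by
  have hup : ∀ i ∈ insert r A, Function.update p r t i = Function.update p' r t i := by
    intro i hi
    by_cases hir : i = r
    · simp [hir]
    · rw [Function.update_of_ne hir, Function.update_of_ne hir]
      exact h i (Finset.mem_of_mem_insert_of_ne hi hir)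
  intro j hj
  rw [← hup j hj, ← I.memory_congr hup]
  exact hadm j hj

/-- A request is started at the first time at the head of the queue at which it is admissible. -/
lemma Phase2.head {p : Fin I.n → ℕ} {t : ℕ} {A : Finset (Fin I.n)} {r : Fin I.n}
    {L : List (Fin I.n)} (h : I.Phase2 p t A (r :: L)) :
    t ≤ p r ∧ I.Admissible p (p r) A r ∧ I.Phase2 p (p r) (insert r A) L ∧
      ∀ u, t ≤ u → u < p r → ¬ I.Admissible p u A r := by
  generalize hQ : r :: L = Q at h
  induction h with
  | done => cases hQ
  | start hadm hp hrest _ =>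
    cases hQ
    subst hp
    exact ⟨le_rfl, hadm, hrest, fun u h1 h2 => absurd h1 (not_le.mpr h2)⟩
  | wait hadm _ ih =>
    obtain ⟨h1, h2, h3, h4⟩ := ih hQ
    cases hQ
    refine ⟨by omega, h2, h3, fun u hu hu' => ?_⟩
    rcases hu.eq_or_lt with rfl | hlt
    · exact hadm
    · exact h4 u hlt hu'

/-- The converse of `Phase2.head`. -/
lemma phase2_cons {p : Fin I.n → ℕ} {A : Finset (Fin I.n)} {r : Fin I.n} {L : List (Fin I.n)}
    (hadm : I.Admissible p (p r) A r) (hrest : I.Phase2 p (p r) (insert r A) L) {t : ℕ}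
    (ht : t ≤ p r) (hwait : ∀ u, t ≤ u → u < p r → ¬ I.Admissible p u A r) :
    I.Phase2 p t A (r :: L) := by
  induction ht using Nat.decreasingInduction with
  | self => exact .start hadm rfl hrest
  | of_succ k hk ih =>
    exact .wait (hwait k le_rfl hk) (ih fun u hu => hwait u (by omega))

lemma Phase2.feasibleOn {p : Fin I.n → ℕ} {t : ℕ} {A : Finset (Fin I.n)} {L : List (Fin I.n)}
    (h : I.Phase2 p t A L) (hA : I.FeasibleOn p A) : I.FeasibleOn p (A ∪ L.toFinset) := by
  induction h with
  | done => simpa using hA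
  | @start t A r L hadm hp _ ih =>
    subst hp
    have := ih (Admissible.feasibleOn I hadm)
    rwa [List.toFinset_cons, Finset.union_insert, ← Finset.insert_union]
  | wait _ _ ih => exact ih hA

lemma IsSortedF.feasible {p : Fin I.n → ℕ} (h : I.IsSortedF p) : I.Feasible p := by
  obtain ⟨L, h1, h2⟩ := h
  have := Phase2.feasibleOn I h2 (fun j hj => absurd hj (Finset.notMem_empty j))
  rw [Finset.empty_union, h1.toFinset_eq] at this
  exact fun t => I.memory_le_of_completion this t

/-! ### Start times of a batch, and existence of runs -/

/-- Starting the requests of a feasible batch one after the other, in ascending order of `o`,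
keeps it feasible: when `j` completes, only requests that started no earlier than `j` are still
active, and those have made less progress than in the simultaneous batch. -/
lemma feasibleOn_of_staggered {X Y : Finset (Fin I.n)} (hX : I.BatchFeasible X) (hYX : Y ⊆ X)
    {p : Fin I.n → ℕ}
    (hord : ∀ i ∈ Y, ∀ j ∈ Y, (p i ≤ p j ∧ I.o i ≤ I.o j) ∨ (p j ≤ p i ∧ I.o j ≤ I.o i)) :
    I.FeasibleOn p Y := by
  intro j hj
  refine le_trans ?_ (hX j (hYX hj))
  unfold memory
  have hact : ∀ i ∈ Y.filter (fun i => p i < p j + I.o j ∧ p j + I.o j ≤ p i + I.o i),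
      p j ≤ p i ∧ I.o j ≤ I.o i := by
    intro i hi
    rw [Finset.mem_filter] at hi
    rcases hord i hi.1 j hj with h | h <;> omega
  calc ∑ i ∈ Y with p i < p j + I.o j ∧ p j + I.o j ≤ p i + I.o i, (I.s i + (p j + I.o j - p i))
      ≤ ∑ i ∈ Y with p i < p j + I.o j ∧ p j + I.o j ≤ p i + I.o i, (I.s i + (I.o j - 0)) :=
        Finset.sum_le_sum fun i hi => by
          have := hact i hi
          omega
    _ ≤ _ := by
        refine Finset.sum_le_sum_of_subset fun i hi => ?_
        have h1 := hact i hi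
        have h2 := I.o_pos j
        rw [Finset.mem_filter] at hi ⊢
        exact ⟨hYX hi.1, h2, by simpa using h1.2⟩

/-- The head `r` of the queue is admissible at time `T` if all requests started so far either
belong to the batch of `r` or are completed by time `T`. -/
lemma admissible_of_batch {X D Y : Finset (Fin I.n)} (hX : I.BatchFeasible X) {p : Fin I.n → ℕ}
    {T : ℕ} {r : Fin I.n} (hfeas : I.FeasibleOn p (D ∪ Y)) (hr : r ∉ D ∪ Y) (hrX : r ∈ X)
    (hYX : Y ⊆ X) (hD : ∀ j ∈ D, p j + I.o j ≤ T) (hYT : ∀ j ∈ Y, p j ≤ T ∧ I.o j ≤ I.o r)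
    (hord : ∀ i ∈ Y, ∀ j ∈ Y, (p i ≤ p j ∧ I.o i ≤ I.o j) ∨ (p j ≤ p i ∧ I.o j ≤ I.o i)) :
    I.Admissible p T (D ∪ Y) r := by
  classical
  have hne : ∀ i ∈ D ∪ Y, Function.update p r T i = p i := fun i hi =>
    Function.update_of_ne (fun h : i = r => hr (h ▸ hi)) _ _
  have hself : Function.update p r T r = T := Function.update_self _ _ _
  intro j hj
  by_cases hc : Function.update p r T j + I.o j ≤ T
  · have hjA : j ∈ D ∪ Y := by
      refine Finset.mem_of_mem_insert_of_ne hj fun h => ?_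
      rw [h, hself] at hc
      have := I.o_pos r
      omega
    rw [I.memory_eq_of_subset (Finset.subset_insert r (D ∪ Y)), I.memory_congr hne, hne j hjA]
    · exact hfeas j hjA
    · intro i hi hi'
      rw [(Finset.mem_insert.mp hi).resolve_right hi', hself]
      omega
  · rw [not_le] at hc
    have hmem : ∀ i ∈ insert r (D ∪ Y), i ∉ insert r Y → i ∈ D := by
      intro i hi hi'
      simp only [Finset.mem_insert, Finset.mem_union, not_or] at hi hi'
      tauto
    have hDc : ∀ i ∈ D, Function.update p r T i + I.o i ≤ T := fun i hi => by
      rw [hne i (Finset.mem_union_left _ hi)]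
      exact hD i hi
    have hjY : j ∈ insert r Y := by
      by_contra h
      have := hDc j (hmem j hj h)
      omega
    rw [I.memory_eq_of_subset (X := insert r Y)
      (Finset.insert_subset_insert r Finset.subset_union_right)]
    · refine I.feasibleOn_of_staggered hX (Finset.insert_subset hrX hYX) ?_ j hjY
      intro i hi k hk
      rcases Finset.mem_insert.mp hi with rfl | hiY
      · rcases Finset.mem_insert.mp hk with rfl | hkY
        · exact Or.inl ⟨le_rfl, le_rfl⟩
        · rw [hself, hne k (Finset.mem_union_right _ hkY)]
          exact Or.inr (hYT k hkY)
      · rw [hne i (Finset.mem_union_right _ hiY)]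
        rcases Finset.mem_insert.mp hk with rfl | hkY
        · rw [hself]
          exact Or.inl (hYT i hiY)
        · rw [hne k (Finset.mem_union_right _ hkY)]
          exact hord i hiY k hkY
    · intro i hi hi'
      have := hDc i (hmem i hi hi')
      omega

lemma exists_phase2 (L : List (Fin I.n)) (hL : L.Nodup) (t : ℕ) (A : Finset (Fin I.n))
    (p₀ : Fin I.n → ℕ) (hfeas : I.FeasibleOn p₀ A) (hA : ∀ i ∈ L, i ∉ A) :
    ∃ p, (∀ i, i ∉ L → p i = p₀ i) ∧ I.Phase2 p t A L := by
  classical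
  induction L generalizing t A p₀ with
  | nil => exact ⟨p₀, fun _ _ => rfl, .done⟩
  | cons r L ih =>
    obtain ⟨hrL, hLnd⟩ := List.nodup_cons.mp hL
    have hrA : r ∉ A := hA r List.mem_cons_self
    -- once all requests of `A` are completed, `r` is admissible
    have hex : ∃ u, t ≤ u ∧ I.Admissible p₀ u A r := by
      refine ⟨max t (A.sup fun j => p₀ j + I.o j), le_max_left _ _, ?_⟩
      have h := I.admissible_of_batch (X := {r}) (D := A) (Y := ∅) (p := p₀)
        (T := max t (A.sup fun j => p₀ j + I.o j)) (r := r)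
        (I.batchFeasible_of_sum_le (by simpa using I.fits r)) (by simpa using hfeas)
        (by simpa using hrA) (by simp) (by simp)
        (fun j hj => le_max_of_le_right
          (Finset.le_sup (f := fun j => p₀ j + I.o j) hj)) (by simp) (by simp)
      simpa using h
    obtain ⟨htu, hadm⟩ := Nat.find_spec hex
    set u := Nat.find hex with hu
    obtain ⟨p, hp, hrun⟩ := ih hLnd u (insert r A) (Function.update p₀ r u) hadm (by
      intro i hi
      rw [Finset.mem_insert, not_or]
      exact ⟨fun h => hrL (h ▸ hi), hA i (List.mem_cons_of_mem _ hi)⟩)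
    have hpr : p r = u := by rw [hp r hrL, Function.update_self]
    have hpA : ∀ i ∈ A, p i = p₀ i := fun i hi => by
      rw [hp i fun h => hA i (List.mem_cons_of_mem _ h) hi,
        Function.update_of_ne fun h : i = r => hrA (h ▸ hi)]
    refine ⟨p, fun i hi => ?_, ?_⟩
    · rw [List.mem_cons, not_or] at hi
      rw [hp i hi.2, Function.update_of_ne hi.1]
    · refine I.phase2_cons (hpr ▸ I.admissible_congr (fun i hi => (hpA i hi).symm) hadm)
        (hpr ▸ hrun) (hpr ▸ htu) fun v htv hv hcon => ?_
      rw [hpr] at hv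
      exact Nat.find_min hex hv ⟨htv, I.admissible_congr hpA hcon⟩

lemma exists_isSortedF : ∃ p, I.IsSortedF p := by
  obtain ⟨L, hL⟩ := I.exists_phase1 Finset.univ
  obtain ⟨p, -, hp⟩ := I.exists_phase2 L hL.nodup 0 ∅ (fun _ => 0)
    (fun j hj => absurd hj (Finset.notMem_empty j)) (fun i _ => Finset.notMem_empty i)
  exact ⟨p, L, hL, hp⟩

/-- If everything queued before a batch is completed by time `T`, then the whole batch is started
by time `T`. Here `Y` is the part of the batch that is already started, and `xs` is the rest. -/
lemma Phase2.batch_start {X D : Finset (Fin I.n)} (hX : I.BatchFeasible X) {p : Fin I.n → ℕ}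
    {T : ℕ} (hD : ∀ j ∈ D, p j + I.o j ≤ T) {L : List (Fin I.n)} (xs : List (Fin I.n))
    {t : ℕ} {Y : Finset (Fin I.n)} (hrun : I.Phase2 p t (D ∪ Y) (xs ++ L)) (ht : t ≤ T)
    (hfeas : I.FeasibleOn p (D ∪ Y)) (hYX : Y ⊆ X) (hYt : ∀ j ∈ Y, p j ≤ t)
    (hord : ∀ i ∈ Y, ∀ j ∈ Y, (p i ≤ p j ∧ I.o i ≤ I.o j) ∨ (p j ≤ p i ∧ I.o j ≤ I.o i))
    (hnd : xs.Nodup) (hxs : ∀ i ∈ xs, i ∈ X ∧ i ∉ D ∪ Y) (hsort : xs.Pairwise (I.o · ≤ I.o ·))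
    (hYo : ∀ j ∈ Y, ∀ i ∈ xs, I.o j ≤ I.o i) :
    (∀ i ∈ xs, p i ≤ T) ∧ ∃ t' ≤ T, I.Phase2 p t' (D ∪ (Y ∪ xs.toFinset)) L ∧
      I.FeasibleOn p (D ∪ (Y ∪ xs.toFinset)) := by
  classical
  induction xs generalizing t Y with
  | nil => exact ⟨by simp, t, ht, by simpa using hrun, by simpa using hfeas⟩
  | cons r xs ih =>
    obtain ⟨htr, hadm, hrest, hwait⟩ := Phase2.head I hrun
    obtain ⟨hrX, hrA⟩ := hxs r List.mem_cons_self
    obtain ⟨hrxs, hnd'⟩ := List.nodup_cons.mp hnd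
    obtain ⟨hro, hsort'⟩ := List.pairwise_cons.mp hsort
    have hrT : p r ≤ T := by
      by_contra hlt
      exact hwait T ht (not_le.mp hlt) (I.admissible_of_batch hX hfeas hrA hrX hYX hD
        (fun j hj => ⟨(hYt j hj).trans ht, hYo j hj r List.mem_cons_self⟩) hord)
    have hins : insert r (D ∪ Y) = D ∪ insert r Y := (Finset.union_insert r D Y).symm
    have hlast : ∀ j ∈ Y, p j ≤ p r ∧ I.o j ≤ I.o r := fun j hj =>
      ⟨(hYt j hj).trans htr, hYo j hj r List.mem_cons_self⟩
    obtain ⟨h1, t', ht', h2, h3⟩ := ih (t := p r) (Y := insert r Y) (hins ▸ hrest) hrT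
      (hins ▸ Admissible.feasibleOn I hadm) (Finset.insert_subset hrX hYX)
      (by
        intro j hj
        rcases Finset.mem_insert.mp hj with rfl | hj
        · exact le_rfl
        · exact (hlast j hj).1)
      (by
        intro i hi j hj
        rcases Finset.mem_insert.mp hi with rfl | hiY
        · rcases Finset.mem_insert.mp hj with rfl | hjY
          · exact Or.inl ⟨le_rfl, le_rfl⟩
          · exact Or.inr (hlast j hjY)
        · rcases Finset.mem_insert.mp hj with rfl | hjY
          · exact Or.inl (hlast i hiY)
          · exact hord i hiY j hjY)
      hnd'
      (by
        intro i hi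
        obtain ⟨hiX, hiA⟩ := hxs i (List.mem_cons_of_mem _ hi)
        refine ⟨hiX, ?_⟩
        rw [← hins, Finset.mem_insert, not_or]
        exact ⟨fun h => hrxs (h ▸ hi), hiA⟩)
      hsort'
      (by
        intro j hj i hi
        rcases Finset.mem_insert.mp hj with rfl | hj
        · exact hro i hi
        · exact hYo j hj i (List.mem_cons_of_mem _ hi))
    have hun : insert r Y ∪ xs.toFinset = Y ∪ (r :: xs).toFinset := by
      rw [List.toFinset_cons, Finset.union_insert, Finset.insert_union]
    rw [hun] at h2 h3
    refine ⟨?_, t', ht', h2, h3⟩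
    intro i hi
    rcases List.mem_cons.mp hi with rfl | hi
    · exact hrT
    · exact h1 i hi

/-! ### Comparison with an arbitrary schedule -/

/-- The prices of the requests. Each request of a batch `X`, chosen from the remaining set `R`, is
charged `F X * |R| / 10`. For every time `t`, the first batch with a price above `t` shows that the
schedule `c` leaves at least half as many requests unfinished at time `t` as there are prices
above `t`; and the prices pay for the delays that the batches of Sorted-F cause. -/
lemma Phase1.exists_price {R : Finset (Fin I.n)} {L : List (Fin I.n)} (h : I.Phase1 R L)
    {c : Fin I.n → ℕ} (hc : I.Feasible c) {p : Fin I.n → ℕ} {t T : ℕ} {D : Finset (Fin I.n)}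
    (hrun : I.Phase2 p t D L) (hfeas : I.FeasibleOn p D) (ht : t ≤ T)
    (hD : ∀ j ∈ D, p j + I.o j ≤ T) (hRD : ∀ i ∈ R, i ∉ D) :
    ∃ a : Fin I.n → ℚ,
      (∀ u : ℕ, (R.filter (fun i => (u : ℚ) < a i)).card ≤
        2 * (R.filter (fun i => u < c i + I.o i)).card) ∧
      ((∑ i ∈ R, (p i + I.o i) : ℕ) : ℚ) ≤ T * R.card + 20 * ∑ i ∈ R, a i := by
  classical
  induction h generalizing t T D with
  | done => exact ⟨fun _ => 0, by simp, by simp⟩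
  | @batch R xs L hnd hbest hsort hL ih =>
    set X := xs.toFinset with hXdef
    have hXR : X ⊆ R := hbest.1.1
    have hXne : X.Nonempty := hbest.1.2.1
    have hmemX : ∀ i, i ∈ xs ↔ i ∈ X := fun i => List.mem_toFinset.symm
    obtain ⟨hstart, t', ht', hrun', hfeas'⟩ := Phase2.batch_start I hbest.1.2.2 hD xs (Y := ∅)
      (by simpa using hrun) ht (by simpa using hfeas) (by simp) (by simp) (by simp) hnd
      (fun i hi => ⟨(hmemX i).mp hi, by simpa using hRD i (hXR ((hmemX i).mp hi))⟩) hsort (by simp)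
    rw [Finset.empty_union, ← hXdef] at hrun' hfeas'
    obtain ⟨m, hmX, hmax⟩ := Finset.exists_max_image X I.o hXne
    have hcompl : ∀ i ∈ X, p i + I.o i ≤ T + I.o m := fun i hi =>
      add_le_add (hstart i ((hmemX i).mpr hi)) (hmax i hi)
    obtain ⟨a', hcount', hsum'⟩ := ih (T := T + I.o m) hrun' hfeas' (by omega)
      (by
        intro j hj
        rcases Finset.mem_union.mp hj with hj | hj
        · have := hD j hj
          omega
        · exact hcompl j hj)
      (by
        intro i hi
        rw [Finset.mem_sdiff] at hi
        rw [Finset.mem_union, not_or]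
        exact ⟨hRD i hi.1, hi.2⟩)
    have hF := I.F_pos hXne
    refine ⟨fun i => if i ∈ X then I.F X * R.card / 10 else a' i, fun u => ?_, ?_⟩
    · by_cases hu : (u : ℚ) < I.F X * R.card / 10
      · have h1 := IsBestBatch.F_mul_card_completed_le I hbest hc u
        have h2 : R.card = (R.filter (fun i => c i + I.o i ≤ u)).card +
            (R.filter (fun i => u < c i + I.o i)).card := by
          rw [← Finset.card_filter_add_card_filter_not (s := R) (fun i => c i + I.o i ≤ u)]
          simp only [not_le]
        have h3 : 2 * ((R.filter (fun i => c i + I.o i ≤ u)).card : ℚ) < R.card := by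
          by_contra hcon
          have := mul_le_mul_of_nonneg_left (not_lt.mp hcon) hF.le
          linarith
        have h4 : 2 * (R.filter (fun i => c i + I.o i ≤ u)).card < R.card := by
          exact_mod_cast h3
        refine (Finset.card_filter_le _ _).trans ?_
        omega
      · have hsub : (R.filter (fun i => (u : ℚ) <
              if i ∈ X then I.F X * R.card / 10 else a' i)) ⊆
            (R \ X).filter (fun i => (u : ℚ) < a' i) := by
          intro i hi
          rw [Finset.mem_filter] at hi
          by_cases hiX : i ∈ X
          · rw [if_pos hiX] at hi
            exact absurd hi.2 hu
          · rw [if_neg hiX] at hi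
            exact Finset.mem_filter.mpr ⟨Finset.mem_sdiff.mpr ⟨hi.1, hiX⟩, hi.2⟩
        refine (Finset.card_le_card hsub).trans ((hcount' u).trans ?_)
        exact Nat.mul_le_mul_left 2
          (Finset.card_le_card (Finset.filter_subset_filter _ Finset.sdiff_subset))
    · have hsplit := Finset.sum_sdiff (f := fun i => p i + I.o i) hXR
      have hXsum : ∑ i ∈ X, (p i + I.o i) ≤ X.card * (T + I.o m) := by
        rw [← smul_eq_mul]
        exact Finset.sum_le_card_nsmul _ _ _ hcompl
      have hcard : (R \ X).card + X.card = R.card := Finset.card_sdiff_add_card_eq_card hXR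
      have ha : ∑ i ∈ R, (if i ∈ X then I.F X * R.card / 10 else a' i) =
          ∑ i ∈ R \ X, a' i + X.card * (I.F X * R.card / 10) := by
        rw [← Finset.sum_sdiff hXR]
        congr 1
        · exact Finset.sum_congr rfl fun i hi => if_neg (Finset.mem_sdiff.mp hi).2
        · rw [Finset.sum_congr rfl fun i hi => if_pos hi, Finset.sum_const, nsmul_eq_mul]
      have hd := mul_le_mul_of_nonneg_right (IsBestBatch.o_le I hbest hmX)
        (Nat.cast_nonneg R.card : (0 : ℚ) ≤ R.card)
      rw [ha, ← hsplit]
      have hXsum' : ((∑ i ∈ X, (p i + I.o i) : ℕ) : ℚ) ≤ X.card * (T + I.o m) := by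
        exact_mod_cast hXsum
      have hcard' : ((R \ X).card : ℚ) + X.card = R.card := by exact_mod_cast hcard
      rw [Nat.cast_add]
      push_cast at hsum' hXsum' ⊢
      rw [← hcard'] at hd ⊢
      linarith

/-- If for every `u` at most twice as many of the `a i` as of the `b i` exceed `u`, then
`∑ a ≤ 2 * ∑ b`. -/
lemma sum_le_two_mul_sum_of_card_le {ι : Type*} (S : Finset ι) (a : ι → ℚ) (b : ι → ℕ)
    (h : ∀ u : ℕ, (S.filter (fun i => (u : ℚ) < a i)).card ≤
      2 * (S.filter (fun i => u < b i)).card) :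
    ∑ i ∈ S, a i ≤ 2 * ((∑ i ∈ S, b i : ℕ) : ℚ) := by
  have layer : ∀ (g : ι → ℕ) (N : ℕ), (∀ i ∈ S, g i ≤ N) →
      ∑ i ∈ S, g i = ∑ u ∈ Finset.range N, (S.filter (fun i => u < g i)).card := by
    intro g N hg
    simp_rw [Finset.card_filter]
    rw [Finset.sum_comm]
    refine Finset.sum_congr rfl fun i hi => ?_
    rw [← Finset.card_filter]
    have : (Finset.range N).filter (fun u => u < g i) = Finset.range (g i) := by
      ext u
      have := hg i hi
      simp only [Finset.mem_filter, Finset.mem_range]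
      omega
    rw [this, Finset.card_range]
  let N := S.sup (fun i => ⌈a i⌉₊) + S.sup b
  have h1 := layer (fun i => ⌈a i⌉₊) N fun i hi =>
    (Finset.le_sup (f := fun i => ⌈a i⌉₊) hi).trans (Nat.le_add_right _ _)
  have h2 := layer b N fun i hi => (Finset.le_sup (f := b) hi).trans (Nat.le_add_left _ _)
  have h3 : ∑ i ∈ S, ⌈a i⌉₊ ≤ 2 * ∑ i ∈ S, b i := by
    rw [h1, h2, Finset.mul_sum]
    refine Finset.sum_le_sum fun u _ => ?_
    simpa only [Nat.lt_ceil] using h u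
  calc ∑ i ∈ S, a i ≤ ∑ i ∈ S, (⌈a i⌉₊ : ℚ) := Finset.sum_le_sum fun i _ => Nat.le_ceil _
    _ ≤ _ := by exact_mod_cast h3

/-- The factor `40` is the factor `20` between prices and delays times the factor `2` between the
number of high prices and the number of unfinished requests. -/
lemma IsSortedF.TEL_le {p : Fin I.n → ℕ} (h : I.IsSortedF p) {c : Fin I.n → ℕ}
    (hc : I.Feasible c) : I.TEL p ≤ 40 * I.TEL c := by
  obtain ⟨L, h1, h2⟩ := h
  obtain ⟨a, hcount, hsum⟩ := Phase1.exists_price I h1 hc (T := 0) h2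
    (fun j hj => absurd hj (Finset.notMem_empty j)) le_rfl (by simp) (by simp)
  have h3 := sum_le_two_mul_sum_of_card_le _ a (fun i => c i + I.o i) hcount
  have h4 : (I.TEL p : ℚ) ≤ 40 * I.TEL c := by
    unfold TEL
    push_cast at hsum h3 ⊢
    linarith
  exact_mod_cast h4

lemma exists_feasible_TEL_eq_OPT : ∃ c, I.Feasible c ∧ I.TEL c = I.OPT := by
  obtain ⟨p, hp⟩ := I.exists_isSortedF
  exact Nat.sInf_mem (s := {T | ∃ p, I.Feasible p ∧ I.TEL p = T})
    ⟨I.TEL p, p, IsSortedF.feasible I hp, rfl⟩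

lemma TEL_pos (p : Fin I.n → ℕ) : 0 < I.TEL p :=
  Finset.sum_pos (fun i _ => Nat.add_pos_right _ (I.o_pos i)) ⟨⟨0, I.n_pos⟩, Finset.mem_univ _⟩

end Inst

lemma competitiveRatio_le : competitiveRatio ≤ 40 := by
  refine iSup_le fun I => iSup_le fun p => iSup_le fun hp => ?_
  obtain ⟨c, hc, hcT⟩ := I.exists_feasible_TEL_eq_OPT
  have h1 := Inst.IsSortedF.TEL_le I hp hc
  rw [← hcT]
  refine ENNReal.div_le_of_le_mul ?_
  exact_mod_cast h1

end KVSched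

theorem mainTheorem1 :
    (∀ I : KVSched.Inst,
      (∃ p, I.IsSortedF p) ∧ ∀ p, I.IsSortedF p → I.Feasible p) ∧
    KVSched.competitiveRatio < 48 := by
  refine ⟨fun I => ⟨I.exists_isSortedF, fun p hp => KVSched.Inst.IsSortedF.feasible I hp⟩, ?_⟩
  exact KVSched.competitiveRatio_le.trans_lt (by norm_num)
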